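/- **Conventions.** Turing machines have one two-way infinite tape, a finite tape alphabet with a blank, and a final state on entering which they stop. All words are over finite alphabets equipped with a linear order; $|x|$ is the length of $x$; words of equal length are compared lexicographically; $\{0,1\}$ is ordered by $0<1$. A *distributional decision problem* $(D,\mu)$ over an alphabet $\Sigma$ consists of a set $D^+\subseteq\Sigma^*$ of positive instances and, for each $n\ge 0$, a probability measure $\mu_n$ on $\Sigma^n$. It belongs to **DistNP** if $D^+\in\mathbf{NP}$ and the function $\mu^*(x)=\mu_{|x|}\{y\in\Sigma^{|x|}: y<x\}$ is polynomial time computable, i.e. a deterministic Turing machine computes from $x$ and $k$, in time polynomial in $|x|+k$, a binary fraction $r$ with $|\mu^*(x)-r|<2^{-k}$. A function $f:\Sigma^*\to\Pi^*$ is a *Ptime reduction* of $D$ to $E$ if it is computable in polynomial time and $x\in D^+\Leftrightarrow f(x)\in E^+$ for all $x$; it is *size-invariant* if $|x_1|<|x_2|\Leftrightarrow|f(x_1)|<|f(x_2)|$ for all $x_1,x_2$, and then its *size growth* is the function $\mathcal S_f$ with $|f(x)|=\mathcal S_f(|x|)$ for all $x$. For $(D,\mu),(E,\nu)\in\mathbf{DistNP}$,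 a *CS-reduction* of $(D,\mu)$ to $(E,\nu)$ is a size-invariant Ptime reduction $f$ of $D$ to $E$ such that $\nu$ is the $f$-transfer of $\mu$: for every $y\in\Pi^*$, $$\nu_{|y|}(y)=\sum_{x:\,f(x)=y}\mu_{|x|}(x)\ \text{ if } |y|=|f(z)| \text{ for some } z,\qquad \nu_{|y|}(y)=|\Pi|^{-|y|}\ \text{ otherwise.}$$ A deterministic Turing machine $M$ *SGPtime decides* $(D,\mu)$ if, whenever it stops on an input $x$, it answers correctly whether $x\in D^+$ or answers "don't know", and there is a polynomial $p$ such that for every nonzero polynomial $q$ $$\mu_n\{x\in\Sigma^n : T_M(x)>p(n)\}=o(1/q(n))\qquad(n\to\infty),$$ where $T_M(x)$ is the number of steps of $M$ on $x$, and $T_M(x)=\infty$ if $M$ does not stop or answers "don't know". For $(D,\mu),(E,\nu)\in\mathbf{DistNP}$, an *SGPtime reduction* of $(D,\mu)$ to $(E,\nu)$ is a size-invariant Ptime reduction $f$ of $D$ to $E$ such that, for every $M$ that SGPtime decides $(E,\nu)$, the composition $M\circ f$ SGPtime decides $(D,\mu)$. Here $M\circ f$ denotes a deterministic machine that on $x$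 stops if and only if $M$ stops on $f(x)$, then with the same answer, and after at most $c(|x|)$ more steps than $M$ needs on $f(x)$, for some polynomial $c$. (The condition means that such machines exist and that each of them SGPtime decides $(D,\mu)$.) **Theorem.** Let $(D,\mu)\in\mathbf{DistNP}$ be a distributional decision problem over a finite alphabet $\Sigma$. Then there exist a distributional decision problem $(E,\nu)\in\mathbf{DistNP}$ over the binary alphabet $\{0,1\}$ and a CS-reduction $f:\Sigma^*\to\{0,1\}^*$ of $(D,\mu)$ to $(E,\nu)$ with linear size growth: there is a constant $c$ such that $\mathcal S_f(n)\le c\,n$ for all $n$. Moreover, $f$ is an SGPtime reduction of $(D,\mu)$ to $(E,\nu)$. -/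

import Mathlib

open Polynomial

noncomputable section

namespace GenericNP

/-! ### One-tape Turing machines -/

/-- A (possibly nondeterministic) one-tape Turing machine with input alphabet `α` and output
alphabet `β`. The finite tape alphabet `Γ` has a distinguished blank symbol `default`;
input and output letters are (written as) nonblank tape symbols. -/
structure TM (α : Type*) (β : Type*) where
  /-- states -/
  Q : Type
  /-- tape symbols, the blank being `default` -/
  Γ : Type
  [finiteQ : Finite Q]
  [finiteΓ : Finite Γ]
  [inhabitedΓ : Inhabited Γ]
  /-- how input letters are written on the tape -/
  inp : α → Γ
  inp_injective : Function.Injective inp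
  inp_ne_blank : ∀ a, inp a ≠ default
  /-- how output letters are written on the tape -/
  out : β → Γ
  out_injective : Function.Injective out
  out_ne_blank : ∀ b, out b ≠ default
  /-- the initial state -/
  start : Q
  /-- the final state -/
  final : Q
  /-- the transition relation: `(q', a', d) ∈ δ q a` means that in state `q`, scanning `a`, the
  machine may enter state `q'`, write `a'` and move the head in direction `d` -/
  δ : Q → Γ → Set (Q × Γ × Turing.Dir)

attribute [instance] TM.finiteQ TM.finiteΓ TM.inhabitedΓ

/-- The answers of a machine to a decision problem. -/
inductive Answer
  | yes
  | no
  | dontKnow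

/-- With `a₀ = false`, `a₁ = true`: the word which the output must start with. -/
def Answer.code : Answer → List Bool
  | .yes => [true, true]
  | .no => [true, false]
  | .dontKnow => [false]

namespace TM

variable {α β : Type*}

/-- A machine is deterministic if its transition relation is a function. -/
def Deterministic (M : TM α β) : Prop :=
  ∀ q a, ∃! t, t ∈ M.δ q a

/-- A configuration: the current state, and the two-way infinite tape together with the
position of the head. -/
structure Cfg (M : TM α β) where
  state : M.Q
  tape : Turing.Tape M.Γ

/-- `c` yields `c'` in one step. The machine stops as soon as it enters the final state. -/
def Step (M : TM α β) (c c' : M.Cfg) : Prop :=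
  c.state ≠ M.final ∧
    ∃ t ∈ M.δ c.state c.tape.head, c' = ⟨t.1, (c.tape.write t.2.1).move t.2.2⟩

/-- `c` yields `c'` in exactly `k` steps. -/
def Yields (M : TM α β) : ℕ → M.Cfg → M.Cfg → Prop
  | 0, c, c' => c = c'
  | k + 1, c, c' => ∃ d, M.Step c d ∧ M.Yields k d c'

/-- The initial configuration on the input `x`: the head scans the first letter of `x`. -/
def init (M : TM α β) (x : List α) : M.Cfg :=
  ⟨M.start, Turing.Tape.mk₁ (x.map M.inp)⟩

/-- On the input `x` the machine can stop after `k` steps, in the configuration `c`. -/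
def HaltsIn (M : TM α β) (x : List α) (k : ℕ) (c : M.Cfg) : Prop :=
  M.Yields k (M.init x) c ∧ c.state = M.final

/-- The tape contains exactly the word `y`, and the head scans its first letter. -/
def Outputs (M : TM α β) (c : M.Cfg) (y : List β) : Prop :=
  c.tape = Turing.Tape.mk₁ (y.map M.out)

/-- To the left of the head the tape is blank, and from the head on it starts with the word
that encodes the answer `a`. -/
def Answers (M : TM α Bool) (c : M.Cfg) (a : Answer) : Prop :=
  ∃ l : List M.Γ, c.tape = Turing.Tape.mk₁ (a.code.map M.out ++ l)

/-- The running time `T_M(x)`: the number of steps after which `M` stops on `x` with the answer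
"yes" or "no"; it is infinite if `M` does not stop or answers "don't know". -/
def runTime (M : TM α Bool) (x : List α) : ℕ∞ :=
  sInf {t : ℕ∞ | ∃ (k : ℕ) (c : M.Cfg), t = k ∧ M.HaltsIn x k c ∧
    (M.Answers c .yes ∨ M.Answers c .no)}

/-- Whenever `M` stops, it answers correctly or answers "don't know". -/
def PartiallyDecides (M : TM α Bool) (L : Set (List α)) : Prop :=
  ∀ x k c, M.HaltsIn x k c →
    (M.Answers c .yes ∧ x ∈ L) ∨ (M.Answers c .no ∧ x ∉ L) ∨ M.Answers c .dontKnow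

/-- `P` is a composition `M ∘ f`, for a function `f` that is computed in polynomial time: it is
deterministic, stops on `x` if and only if `M` stops on `f x`, gives then the same answer, and
takes at most polynomially many (in `|x|`) more steps than `M` takes on `f x`. -/
def IsComposition (P : TM α Bool) (M : TM β Bool) (f : List α → List β) : Prop :=
  P.Deterministic ∧ ∃ p : ℕ[X], ∀ x,
    (∀ k c, M.HaltsIn (f x) k c → ∃ k' ≤ k + p.eval x.length, ∃ c',
      P.HaltsIn x k' c' ∧ ∀ a, P.Answers c' a ↔ M.Answers c a) ∧
    (∀ k c, P.HaltsIn x k c → ∃ k' c',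
      M.HaltsIn (f x) k' c' ∧ ∀ a, P.Answers c a ↔ M.Answers c' a)

end TM

/-! ### Polynomial time -/

section PolynomialTime

variable {α β : Type*}

/-- `f` is computed by a deterministic machine in polynomial time. -/
def PtimeComputable (f : List α → List β) : Prop :=
  ∃ M : TM α β, M.Deterministic ∧ ∃ p : ℕ[X], ∀ x, ∃ k ≤ p.eval x.length, ∃ c,
    M.HaltsIn x k c ∧ M.Outputs c (f x)

/-- The class **NP**: some nondeterministic machine, all of whose computations on `x` have
polynomially bounded length, has a computation with the answer "yes" on `x` iff `x ∈ L`. -/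
def InNP (L : Set (List α)) : Prop :=
  ∃ (M : TM α Bool) (p : ℕ[X]),
    (∀ x k c, M.Yields k (M.init x) c → k ≤ p.eval x.length) ∧
    ∀ x, x ∈ L ↔ ∃ k c, M.HaltsIn x k c ∧ M.Answers c .yes

/-- The binary fraction `b₀.b₁b₂…bₘ`. -/
def binaryFraction : List Bool → ℝ
  | [] => 0
  | b :: l => (if b then 1 else 0) + binaryFraction l / 2

/-- The pair `(x, k)` as a word: `x` followed by `k` copies of an additional letter. -/
def encodePair (x : List α) (k : ℕ) : List (Option α) :=
  x.map some ++ List.replicate k none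

/-- A real function on words is Ptime computable if a deterministic machine computes, for each
`x` and `k`, in time polynomial in `|x| + k`, a binary fraction `r` with `|g x - r| < 2^(-k)`. -/
def PtimeComputableReal (g : List α → ℝ) : Prop :=
  ∃ M : TM (Option α) Bool, M.Deterministic ∧ ∃ p : ℕ[X], ∀ x k,
    ∃ t ≤ p.eval (x.length + k), ∃ c r,
      M.HaltsIn (encodePair x k) t c ∧ M.Outputs c r ∧
        |g x - binaryFraction r| < (1 / 2 : ℝ) ^ k

/-- `f` is a Ptime (many-to-one) reduction of `L` to `L'`. -/
def IsPtimeReduction (f : List α → List β) (L : Set (List α)) (L' : Set (List β)) : Prop :=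
  PtimeComputable f ∧ ∀ x, x ∈ L ↔ f x ∈ L'

/-- `f` is size-invariant. -/
def SizeInvariant (f : List α → List β) : Prop :=
  ∀ x₁ x₂, x₁.length < x₂.length ↔ (f x₁).length < (f x₂).length

/-- `S` is the size growth of `f`. -/
def HasSizeGrowth (f : List α → List β) (S : ℕ → ℕ) : Prop :=
  ∀ x, (f x).length = S x.length

end PolynomialTime

/-! ### Distributional problems -/

/-- For `μ x = μ_{|x|}(x)`: the measure `μ_n(S ∩ Σⁿ)`. -/
def mass {α : Type*} (μ : List α → ℝ) (n : ℕ) (S : Set (List α)) : ℝ :=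
  ∑ᶠ x ∈ {x : List α | x.length = n ∧ x ∈ S}, μ x

/-- A distributional decision problem over the alphabet `α`: a set of positive instances and a
spherical ensemble `μ` of probability measures, given by `μ x = μ_{|x|}(x)`. -/
structure DistProblem (α : Type*) where
  pos : Set (List α)
  μ : List α → ℝ
  nonneg : ∀ x, 0 ≤ μ x
  total : ∀ n, mass μ n Set.univ = 1

/-- The probability distribution `μ*(x) = μ_{|x|} {y | |y| = |x|, y < x}`; words of the same
length are compared lexicographically. -/
def distribution {α : Type*} [LinearOrder α] (μ : List α → ℝ) (x : List α) : ℝ :=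
  mass μ x.length {y | y < x}

/-- The class **DistNP**. -/
def InDistNP {α : Type*} [LinearOrder α] (D : DistProblem α) : Prop :=
  InNP D.pos ∧ PtimeComputableReal (distribution D.μ)

open Classical in
/-- `ν` is the `f`-transfer of `μ`. -/
def IsTransfer {α β : Type*} (f : List α → List β) (μ : List α → ℝ) (ν : List β → ℝ) : Prop :=
  ∀ y, ν y = if ∃ z, y.length = (f z).length then ∑ᶠ x ∈ {x | f x = y}, μ x
    else ((Nat.card β : ℝ) ^ y.length)⁻¹

/-- `M` decides `D` strongly generically in polynomial time. -/
def SGPDecides {α : Type*} (M : TM α Bool) (D : DistProblem α) : Prop :=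
  M.Deterministic ∧ M.PartiallyDecides D.pos ∧ ∃ p : ℕ[X], ∀ q : ℝ[X], q ≠ 0 →
    (fun n : ℕ => mass D.μ n {x | ((p.eval n : ℕ) : ℕ∞) < M.runTime x})
      =o[Filter.atTop] (fun n : ℕ => 1 / q.eval (n : ℝ))

/-- `f` is a CS-reduction (change of size reduction) of `D` to `E`. -/
structure IsCSReduction {α β : Type*} [LinearOrder α] [LinearOrder β]
    (f : List α → List β) (D : DistProblem α) (E : DistProblem β) : Prop where
  source_mem : InDistNP D
  target_mem : InDistNP E
  reduction : IsPtimeReduction f D.pos E.pos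
  sizeInvariant : SizeInvariant f
  transfer : IsTransfer f D.μ E.μ

/-- `f` is an SGPtime reduction of `D` to `E`: for each `M` which SGPtime decides `E`, the
composition `M ∘ f` SGPtime decides `D`. -/
structure IsSGPReduction {α β : Type*} [LinearOrder α] [LinearOrder β]
    (f : List α → List β) (D : DistProblem α) (E : DistProblem β) : Prop where
  source_mem : InDistNP D
  target_mem : InDistNP E
  reduction : IsPtimeReduction f D.pos E.pos
  sizeInvariant : SizeInvariant f
  composition : ∀ M : TM β Bool, SGPDecides M E →
    (∃ P : TM α Bool, P.IsComposition M f) ∧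
      ∀ P : TM α Bool, P.IsComposition M f → SGPDecides P D

end GenericNP

end

open Polynomial

noncomputable section

namespace GenericNP

/-! ### Deterministic runs -/

namespace TM

variable {α β : Type*}

/-! The reduction is a letter-by-letter code `K.encode` that replaces each letter by a binary block
of fixed length c = |Σ|, in an order preserving way. Lengths are multiplied by c, which gives
size-invariance and linear growth, and injectivity makes the transfer ν simple: at lengths cn it is
μ carried to the code words, at the other lengths it is uniform.

The substantial point is that ν* is polynomial time computable. At length cn, ν*(y) is the μ-measure
of the x with `K.encode x < y`. The code is chosen so that every y of this length has a least x =: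
`K.round y` with y ≤ `K.encode x`; then the condition reads x < `K.round y`
(`BlockCode.encode_lt_iff`), and ν*(y) = μ*(`K.round y`). At other lengths ν*(y) is exactly the
binary fraction 0.y (`ncard_words_lt`). Taking the words that round into D⁺ as positive instances
keeps the target in NP.

Encoding, rounding and counting the length modulo c are finite-state transductions. A single
construction, `Transducer.before`, puts such a transduction in front of an arbitrary, possibly
nondeterministic, machine at quadratic cost, and supplies all the machines that are needed.

For strongly generic decidability, the ν-measure of a set of words of length cn is the μ-measure of
its preimage (`mass_targetMeasure`), so the error estimate for M at length cn bounds that of M ∘ f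
at length n; only the polynomials have to be rescaled by c. -/

/-- `c` leads to `d` in `k` steps, and there is no choice in any of these steps. -/
def DetYields (M : TM α β) : ℕ → M.Cfg → M.Cfg → Prop
  | 0, c, d => c = d
  | k + 1, c, d => ∃ m, (∀ e, M.Step c e ↔ e = m) ∧ M.DetYields k m d

variable {M : TM α β}

lemma DetYields.trans {j k : ℕ} {c d e : M.Cfg} (h₁ : M.DetYields j c d)
    (h₂ : M.DetYields k d e) : M.DetYields (j + k) c e := by
  induction j generalizing c with
  | zero => cases h₁; simpa using h₂
  | succ j ih =>
    obtain ⟨m, hm, h⟩ := h₁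
    rw [Nat.succ_add]
    exact ⟨m, hm, ih h⟩

lemma DetYields.yields_add {j k : ℕ} {c d e : M.Cfg} (h₁ : M.DetYields j c d)
    (h₂ : M.Yields k d e) : M.Yields (j + k) c e := by
  induction j generalizing c with
  | zero => cases h₁; simpa using h₂
  | succ j ih =>
    obtain ⟨m, hm, h⟩ := h₁
    rw [Nat.succ_add]
    exact ⟨m, (hm m).2 rfl, ih h⟩

/-- A computation cannot leave a choice-free run: it either is still inside it, hence not final, or
passes through its end. This controls all computations of a nondeterministic machine, including
unfinished ones. -/
lemma DetYields.of_yields {j k : ℕ} {c d e : M.Cfg} (h₁ : M.DetYields j c d)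
    (h₂ : M.Yields k c e) :
    (k < j ∧ e.state ≠ M.final) ∨ ∃ i, k = j + i ∧ M.Yields i d e := by
  induction j generalizing c k with
  | zero => cases h₁; exact Or.inr ⟨k, by simp, h₂⟩
  | succ j ih =>
    obtain ⟨m, hm, h⟩ := h₁
    cases k with
    | zero => cases h₂; exact Or.inl ⟨by simp, ((hm m).2 rfl).1⟩
    | succ k =>
      obtain ⟨m', hm', h'⟩ := h₂
      cases (hm m').1 hm'
      rcases ih h h' with h | ⟨i, rfl, hi⟩
      · exact Or.inl ⟨by omega, h.2⟩
      · exact Or.inr ⟨i, by omega, hi⟩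

lemma step_iff_of_singleton {c : M.Cfg} {t : M.Q × M.Γ × Turing.Dir} (hc : c.state ≠ M.final)
    (ht : M.δ c.state c.tape.head = {t}) (e : M.Cfg) :
    M.Step c e ↔ e = ⟨t.1, (c.tape.write t.2.1).move t.2.2⟩ := by
  simp [Step, hc, ht]

lemma DetYields.single {c d : M.Cfg} {t : M.Q × M.Γ × Turing.Dir} (hc : c.state ≠ M.final)
    (ht : M.δ c.state c.tape.head = {t}) (hd : d = ⟨t.1, (c.tape.write t.2.1).move t.2.2⟩) :
    M.DetYields 1 c d :=
  ⟨d, fun e => by rw [step_iff_of_singleton hc ht, hd], rfl⟩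

end TM

/-! ### Tapes -/

section Tape

open Turing

variable {Γ : Type*} [Inhabited Γ]

lemma listBlank_append_default (l : List Γ) :
    ListBlank.mk (l ++ [default]) = ListBlank.mk l :=
  Quotient.sound' (Or.inr ⟨1, rfl⟩)

lemma tape_write_move_right (L R : List Γ) (g b : Γ) :
    ((Tape.mk₂ L (g :: R)).write b).move Dir.right = Tape.mk₂ (b :: L) R := by
  simp [Tape.mk₂]

lemma tape_write_nil_move_right (L : List Γ) (b : Γ) :
    ((Tape.mk₂ L []).write b).move Dir.right = Tape.mk₂ (b :: L) [] := by
  simp [Tape.mk₂]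

lemma tape_move_left_cons (L R : List Γ) (a : Γ) :
    (Tape.mk₂ (a :: L) R).move Dir.left = Tape.mk₂ L (a :: R) := by
  simp [Tape.mk₂]

/-- An erased first letter leaves a blank that merges with the blank left half of the tape, so the
shortened word again starts at the head. -/
lemma tape_default_left (R : List Γ) : Tape.mk₂ [default] R = Tape.mk₂ [] R := by
  unfold Tape.mk₂
  rw [← listBlank_append_default []]
  rfl

lemma tape_head_move_left_nil (R : List Γ) :
    ((Tape.mk₂ [] R).move Dir.left).head = default := by
  simp [Tape.mk₂]

end Tape

/-! ### Finite-state transducers as a preprocessing stage -/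

/-- A finite-state transducer which emits, for each input letter, at most `bound` nonblank
symbols. -/
structure Transducer (A Γ : Type) [Inhabited Γ] where
  /-- states -/
  S : Type
  [finiteS : Finite S]
  step : S → A → S
  emit : S → A → List Γ
  bound : ℕ
  length_emit_le : ∀ s a, (emit s a).length ≤ bound
  emit_ne_blank : ∀ s a, ∀ g ∈ emit s a, g ≠ default

attribute [instance] Transducer.finiteS

namespace Transducer

variable {A Γ : Type} [Inhabited Γ] (T : Transducer A Γ)

/-- The state reached from `s` after reading `x`. -/
def run (s : T.S) (x : List A) : T.S := x.foldl T.step s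

/-- The word emitted from the state `s` on `x`. -/
def output : T.S → List A → List Γ
  | _, [] => []
  | s, a :: x => T.emit s a ++ output (T.step s a) x

lemma output_cons (s : T.S) (a : A) (x : List A) :
    T.output s (a :: x) = T.emit s a ++ T.output (T.step s a) x := rfl

/-- The states of the machine which first runs a transducer and then a machine. -/
inductive Stage (S L Q : Type)
  | read (s : S)
  | put (s : S) (l : L)
  | back (s : S)
  | turn (s : S)
  | main (q : Q)

instance {S L Q : Type} [Finite S] [Finite L] [Finite Q] : Finite (Stage S L Q) := by
  let φ : (S ⊕ S × L) ⊕ (S ⊕ S ⊕ Q) → Stage S L Q := fun z => match z with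
    | .inl (.inl s) => .read s
    | .inl (.inr (s, l)) => .put s l
    | .inr (.inl s) => .back s
    | .inr (.inr (.inl s)) => .turn s
    | .inr (.inr (.inr q)) => .main q
  refine Finite.of_surjective φ ?_
  rintro (s | ⟨s, l⟩ | s | s | q)
  · exact ⟨.inl (.inl s), rfl⟩
  · exact ⟨.inl (.inr (s, l)), rfl⟩
  · exact ⟨.inr (.inl s), rfl⟩
  · exact ⟨.inr (.inr (.inl s)), rfl⟩
  · exact ⟨.inr (.inr (.inr q)), rfl⟩

/-- Words of length at most `n`, a finite type. -/
abbrev Buffer (Γ : Type) (n : ℕ) : Type := {l : List Γ // l.length ≤ n}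

instance {Γ : Type} [Finite Γ] (n : ℕ) : Finite (Buffer Γ n) :=
  (List.finite_length_le Γ n).to_subtype

variable {α β γ : Type*}

open Classical in
/-- The transitions of `Transducer.before`. -/
def transition (M : TM β γ) (T : Transducer A M.Γ) (ends : T.S → M.Q) :
    Stage T.S (Buffer M.Γ T.bound) M.Q → M.Γ ⊕ A →
      Set (Stage T.S (Buffer M.Γ T.bound) M.Q × (M.Γ ⊕ A) × Turing.Dir)
  -- The tape holds a queue: unread letters (`inr`), then emitted symbols (`inl`). One round erases
  -- the first letter, appends its emission at the right end and returns to the left. A symbol `inl`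
  -- in first place means that the input is used up; since every step moves the head, `M` is entered
  -- by a step right and a step left.
  | .read s, .inl g => {(.turn s, .inl g, .right)}
  | .read s, .inr a =>
    {(.put (T.step s a) ⟨T.emit s a, T.length_emit_le s a⟩, .inl default, .right)}
  | .put s ⟨l, hl⟩, g =>
    if g = .inl default then
      match l, hl with
      | [], _ => {(.back s, g, .left)}
      | b :: l', h => {(.put s ⟨l', (Nat.le_succ _).trans h⟩, .inl b, .right)}
    else {(.put s ⟨l, hl⟩, g, .right)}
  | .back s, g => if g = .inl default then {(.read s, g, .right)} else {(.back s, g, .left)}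
  | .turn s, g => {(.main (ends s), g, .left)}
  | .main q, g =>
    (fun t => (.main t.1, .inl t.2.1, t.2.2)) '' M.δ q (g.elim id fun _ => default)

/-- The machine which runs the transducer `T` from the state `s₀` on its input, and then the
machine `M` on the word emitted; the state in which `M` is started depends on the final state
of `T`. -/
def before (M : TM β γ) (T : Transducer A M.Γ) [Finite A] (ends : T.S → M.Q) (s₀ : T.S)
    (ι : α → A) (hι : Function.Injective ι) : TM α γ where
  Q := Stage T.S (Buffer M.Γ T.bound) M.Q
  Γ := M.Γ ⊕ A
  inhabitedΓ := ⟨.inl default⟩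
  inp a := .inr (ι a)
  inp_injective := Sum.inr_injective.comp hι
  inp_ne_blank _ := Sum.inr_ne_inl
  out b := .inl (M.out b)
  out_injective := Sum.inl_injective.comp M.out_injective
  out_ne_blank b h := M.out_ne_blank b (Sum.inl_injective h)
  start := .read s₀
  final := .main M.final
  δ := transition M T ends

/-! ### Correctness and running time of the preprocessing stage -/

section Before

variable [Finite A] {M : TM β γ} {T : Transducer A M.Γ} {ends : T.S → M.Q} {s₀ : T.S}
  {ι : α → A} {hι : Function.Injective ι}

lemma before_deterministic (hM : M.Deterministic) :
    (before M T ends s₀ ι hι).Deterministic := by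
  have key : ∀ (q : Stage T.S (Buffer M.Γ T.bound) M.Q) (g : M.Γ ⊕ A),
      ∃! t, t ∈ transition M T ends q g := by
    rintro (s | ⟨s, _ | ⟨b, l⟩, hl⟩ | s | s | q) g
    · cases g <;> simp [transition]
    · by_cases hg : g = .inl default <;> simp [transition, hg]
    · by_cases hg : g = .inl default <;> simp [transition, hg]
    · by_cases hg : g = .inl default <;> simp [transition, hg]
    · simp [transition]
    · obtain ⟨t, ht, hu⟩ := hM q (g.elim id fun _ => default)
      refine ⟨_, ⟨t, ht, rfl⟩, ?_⟩
      rintro _ ⟨t', ht', rfl⟩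
      rw [hu t' ht']
  exact key

/-- The inclusion of the tape alphabet of `M`. -/
def inlMap (M : TM β γ) (T : Transducer A M.Γ) (ends : T.S → M.Q) (s₀ : T.S)
    (ι : α → A) (hι : Function.Injective ι) :
    Turing.PointedMap M.Γ (before M T ends s₀ ι hι).Γ :=
  ⟨Sum.inl, rfl⟩

/-- The letters of `A` as tape symbols. -/
def letter (M : TM β γ) (T : Transducer A M.Γ) (ends : T.S → M.Q) (s₀ : T.S)
    (ι : α → A) (hι : Function.Injective ι) : A → (before M T ends s₀ ι hι).Γ := Sum.inr

/-- The retraction onto the tape alphabet of `M`. -/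
def retract (M : TM β γ) (T : Transducer A M.Γ) (ends : T.S → M.Q) (s₀ : T.S)
    (ι : α → A) (hι : Function.Injective ι) :
    Turing.PointedMap (before M T ends s₀ ι hι).Γ M.Γ :=
  ⟨Sum.elim id fun _ => default, rfl⟩

/-- A configuration of `M` as a configuration of `before M T ends s₀ ι hι`. -/
def embed (M : TM β γ) (T : Transducer A M.Γ) (ends : T.S → M.Q) (s₀ : T.S)
    (ι : α → A) (hι : Function.Injective ι) (c : M.Cfg) : (before M T ends s₀ ι hι).Cfg :=
  ⟨Stage.main c.state, c.tape.map (inlMap M T ends s₀ ι hι)⟩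

/-- On embedded configurations the head reads an `inl` symbol and the transitions are the image of
those of `M`. The equivalence, not just simulation, is needed because `M` may be nondeterministic.
-/
lemma step_embed_iff (c : M.Cfg) (e : (before M T ends s₀ ι hι).Cfg) :
    (before M T ends s₀ ι hι).Step (embed M T ends s₀ ι hι c) e ↔
      ∃ d, M.Step c d ∧ e = embed M T ends s₀ ι hι d := by
  have hst : (embed M T ends s₀ ι hι c).state ≠ (before M T ends s₀ ι hι).final ↔
      c.state ≠ M.final := by
    show Stage.main c.state ≠ Stage.main M.final ↔ _
    simp
  have hδ : (before M T ends s₀ ι hι).δ (embed M T ends s₀ ι hι c).state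
      (embed M T ends s₀ ι hι c).tape.head =
      (fun t => (Stage.main t.1, Sum.inl t.2.1, t.2.2)) '' M.δ c.state c.tape.head := rfl
  have hcfg : ∀ t : M.Q × M.Γ × Turing.Dir,
      embed M T ends s₀ ι hι ⟨t.1, (c.tape.write t.2.1).move t.2.2⟩ =
        ⟨Stage.main t.1, ((embed M T ends s₀ ι hι c).tape.write (inlMap M T ends s₀ ι hι t.2.1)).move t.2.2⟩ := by
    intro t
    simp only [embed, Turing.Tape.map_move, Turing.Tape.map_write]
  unfold TM.Step
  rw [hst, hδ]
  constructor
  · rintro ⟨h, _, ⟨t, ht, rfl⟩, rfl⟩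
    exact ⟨_, ⟨h, t, ht, rfl⟩, (hcfg t).symm⟩
  · rintro ⟨_, ⟨h, t, ht, rfl⟩, rfl⟩
    exact ⟨h, _, ⟨t, ht, rfl⟩, hcfg t⟩

lemma yields_embed_iff (k : ℕ) (c : M.Cfg) (e : (before M T ends s₀ ι hι).Cfg) :
    (before M T ends s₀ ι hι).Yields k (embed M T ends s₀ ι hι c) e ↔
      ∃ d, M.Yields k c d ∧ e = embed M T ends s₀ ι hι d := by
  induction k generalizing c with
  | zero => simp [TM.Yields, eq_comm]
  | succ k ih =>
    simp only [TM.Yields, step_embed_iff]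
    constructor
    · rintro ⟨_, ⟨d, hd, rfl⟩, h⟩
      obtain ⟨d', hd', rfl⟩ := (ih d).1 h
      exact ⟨d', ⟨d, hd, hd'⟩, rfl⟩
    · rintro ⟨d', ⟨d, hd, hd'⟩, rfl⟩
      exact ⟨_, ⟨d, hd, rfl⟩, (ih d).2 ⟨d', hd', rfl⟩⟩

lemma embed_state_eq_final_iff (c : M.Cfg) :
    (embed M T ends s₀ ι hι c).state = (before M T ends s₀ ι hι).final ↔ c.state = M.final := by
  show Stage.main c.state = Stage.main M.final ↔ _
  simp

/-- This recovers the tape of `M` from its embedded copy, so that an answer read off the larger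
machine is an answer of `M`. -/
lemma map_retract (t : Turing.Tape M.Γ) :
    (t.map (inlMap M T ends s₀ ι hι)).map (retract M T ends s₀ ι hι) = t := by
  have h : ∀ L : Turing.ListBlank M.Γ,
      (L.map (inlMap M T ends s₀ ι hι)).map (retract M T ends s₀ ι hι) = L := fun L => by
    ext i
    rw [Turing.ListBlank.nth_map, Turing.ListBlank.nth_map]
    rfl
  obtain ⟨a, L, R⟩ := t
  unfold Turing.Tape.map
  simp only [h]
  rfl

lemma embed_outputs {c : M.Cfg} {y : List γ} (h : M.Outputs c y) :
    (before M T ends s₀ ι hι).Outputs (embed M T ends s₀ ι hι c) y := by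
  unfold TM.Outputs at *
  simp only [embed]
  rw [h, Turing.Tape.map_mk₁, List.map_map]
  rfl

lemma embed_answers_iff {M : TM β Bool} {T : Transducer A M.Γ} {ends : T.S → M.Q} {s₀ : T.S}
    (c : M.Cfg) (a : Answer) :
    (before M T ends s₀ ι hι).Answers (embed M T ends s₀ ι hι c) a ↔ M.Answers c a := by
  constructor
  · rintro ⟨l, hl⟩
    refine ⟨l.map (retract M T ends s₀ ι hι), ?_⟩
    rw [← map_retract (ends := ends) (s₀ := s₀) (hι := hι) c.tape]
    change Turing.Tape.map _ (embed M T ends s₀ ι hι c).tape = _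
    rw [hl, Turing.Tape.map_mk₁, List.map_append, List.map_map]
    rfl
  · rintro ⟨l, hl⟩
    refine ⟨l.map (inlMap M T ends s₀ ι hι), ?_⟩
    simp only [embed, hl, Turing.Tape.map_mk₁, List.map_append, List.map_map]
    rfl

section Run

open Turing

/-- The list `L` is stored nearest cell first, whence the reversal. The scan stops at the blank to
the left of the word, which is why no blank may occur in `L`. -/
lemma detYields_back (s : T.S) (L R : List (before M T ends s₀ ι hι).Γ)
    (hL : ∀ g ∈ L, g ≠ default) :
    (before M T ends s₀ ι hι).DetYields (L.length + 1)
      ⟨Stage.back s, (Tape.mk₂ L R).move Dir.left⟩ ⟨Stage.read s, Tape.mk₂ [] (L.reverse ++ R)⟩ := by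
  induction L generalizing R with
  | nil =>
    refine TM.DetYields.single (t := (Stage.read s, default, Dir.right)) (by rintro ⟨⟩) ?_ ?_
    · simp only [tape_head_move_left_nil]
      exact if_pos rfl
    · conv_rhs => rw [← tape_head_move_left_nil R, Tape.write_self]
      simp
  | cons a L ih =>
    have ha : a ≠ default := hL a (by simp)
    rw [List.length_cons, add_comm]
    refine TM.DetYields.trans (j := 1) (d := ⟨Stage.back s, (Tape.mk₂ L (a :: R)).move Dir.left⟩)
      (TM.DetYields.single (t := (Stage.back s, a, Dir.left)) (by rintro ⟨⟩) ?_ ?_) ?_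
    · simp only [tape_move_left_cons]
      exact if_neg ha
    · simp only [tape_move_left_cons]
      have : (Tape.mk₂ L (a :: R)).write a = Tape.mk₂ L (a :: R) :=
        Tape.write_self (Tape.mk₂ L (a :: R))
      rw [this]
    · simpa using ih (a :: R) fun g hg => hL g (by simp [hg])

lemma detYields_skip (s : T.S) (l : Buffer M.Γ T.bound)
    (L R : List (before M T ends s₀ ι hι).Γ) (hR : ∀ g ∈ R, g ≠ default) :
    (before M T ends s₀ ι hι).DetYields R.length
      ⟨Stage.put s l, Tape.mk₂ L R⟩ ⟨Stage.put s l, Tape.mk₂ (R.reverse ++ L) []⟩ := by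
  induction R generalizing L with
  | nil => rfl
  | cons a R ih =>
    have ha : a ≠ default := hR a (by simp)
    rw [List.length_cons, add_comm]
    refine TM.DetYields.trans (j := 1) (d := ⟨Stage.put s l, Tape.mk₂ (a :: L) R⟩)
      (TM.DetYields.single (t := (Stage.put s l, a, Dir.right)) (by rintro ⟨⟩) ?_ ?_) ?_
    · exact if_neg ha
    · rw [tape_write_move_right]
    · simpa using ih (a :: L) fun g hg => hR g (by simp [hg])

lemma detYields_put (s : T.S) (l : List M.Γ) (hl : l.length ≤ T.bound)
    (L : List (before M T ends s₀ ι hι).Γ) :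
    (before M T ends s₀ ι hι).DetYields (l.length + 1) ⟨Stage.put s ⟨l, hl⟩, Tape.mk₂ L []⟩
      ⟨Stage.back s,
        (Tape.mk₂ ((l.map (inlMap M T ends s₀ ι hι)).reverse ++ L) []).move Dir.left⟩ := by
  induction l generalizing L with
  | nil =>
    refine TM.DetYields.single (t := (Stage.back s, default, Dir.left)) (by rintro ⟨⟩) ?_ ?_
    · exact if_pos rfl
    · have : (Tape.mk₂ L []).write default = Tape.mk₂ L [] :=
        Tape.write_self (Tape.mk₂ L [])
      rw [this]
      rfl
  | cons b l ih =>
    have hl' : l.length ≤ T.bound := (Nat.le_succ _).trans hl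
    rw [List.length_cons, add_comm]
    refine TM.DetYields.trans (j := 1) (d := ⟨Stage.put s ⟨l, hl'⟩, Tape.mk₂ (Sum.inl b :: L) []⟩)
      (TM.DetYields.single (t := (Stage.put s ⟨l, hl'⟩, Sum.inl b, Dir.right))
        (by rintro ⟨⟩) ?_ ?_) ?_
    · exact if_pos rfl
    · exact congrArg _ (tape_write_nil_move_right _ _).symm
    · have := ih hl' (Sum.inl b :: L)
      simp only [List.map_cons, List.reverse_cons, List.append_assoc, List.singleton_append]
      exact this

/-- One round of the queue: 1 step to erase, |R| to reach the right end, |emit| + 1 to write and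
turn, |R| + |emit| + 1 to return. -/
lemma detYields_letter (s : T.S) (a : A) (R : List (before M T ends s₀ ι hι).Γ)
    (hR : ∀ g ∈ R, g ≠ default) :
    (before M T ends s₀ ι hι).DetYields (2 * (R.length + (T.emit s a).length) + 3)
      ⟨Stage.read s, Tape.mk₂ [] (Sum.inr a :: R)⟩
      ⟨Stage.read (T.step s a),
        Tape.mk₂ [] (R ++ (T.emit s a).map (inlMap M T ends s₀ ι hι))⟩ := by
  have h₁ : (before M T ends s₀ ι hι).DetYields 1 ⟨Stage.read s, Tape.mk₂ [] (Sum.inr a :: R)⟩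
      ⟨Stage.put (T.step s a) ⟨T.emit s a, T.length_emit_le s a⟩, Tape.mk₂ [] R⟩ := by
    refine TM.DetYields.single (t := (Stage.put (T.step s a) ⟨T.emit s a, T.length_emit_le s a⟩,
      default, Dir.right)) (by rintro ⟨⟩) rfl ?_
    rw [← tape_default_left]
    exact congrArg _ (tape_write_move_right _ _ _ _).symm
  have h₂ := detYields_skip (ends := ends) (s₀ := s₀) (hι := hι) (T.step s a)
    ⟨T.emit s a, T.length_emit_le s a⟩ [] R hR
  have h₃ := detYields_put (ends := ends) (s₀ := s₀) (hι := hι) (T.step s a) (T.emit s a)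
    (T.length_emit_le s a) (R.reverse ++ [])
  have h₄ := detYields_back (ends := ends) (s₀ := s₀) (hι := hι) (T.step s a)
    (((T.emit s a).map (inlMap M T ends s₀ ι hι)).reverse ++ (R.reverse ++ [])) [] ?_
  · have h := ((h₁.trans h₂).trans h₃).trans h₄
    simp only [List.append_nil, List.reverse_append, List.reverse_reverse, List.length_append,
      List.length_reverse, List.length_map] at h
    convert h using 1
    ring
  · intro g hg
    simp only [List.append_nil, List.mem_append, List.mem_reverse, List.mem_map] at hg
    rcases hg with ⟨b, hb, rfl⟩ | hg
    · exact fun h => T.emit_ne_blank s a b hb (Sum.inl_injective h)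
    · exact hR g hg

lemma detYields_finish (s : T.S) (w : List M.Γ) :
    (before M T ends s₀ ι hι).DetYields 2
      ⟨Stage.read s, Tape.mk₂ [] (w.map (inlMap M T ends s₀ ι hι))⟩
      (embed M T ends s₀ ι hι ⟨ends s, Tape.mk₁ w⟩) := by
  set t := Tape.mk₂ [] (w.map (inlMap M T ends s₀ ι hι)) with ht
  have hw : t = (Tape.mk₁ w).map (inlMap M T ends s₀ ι hι) := by rw [Tape.map_mk₁]; rfl
  refine TM.DetYields.trans (j := 1) (k := 1) (d := ⟨Stage.turn s, t.move Dir.right⟩)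
      (TM.DetYields.single (t := (Stage.turn s, t.head, Dir.right)) (by rintro ⟨⟩) ?_ ?_)
      (TM.DetYields.single (t := (Stage.main (ends s), (t.move Dir.right).head, Dir.left))
        (by rintro ⟨⟩) rfl ?_)
  · have : t.head = Sum.inl (Tape.mk₁ w).head := by rw [hw]; rfl
    rw [this]
    rfl
  · simp only [Tape.write_self]
  · simp only [Tape.write_self, Tape.move_right_left, embed, hw]

/-- The induction carries along the word `w` emitted so far. Including the emissions still to come,
the queue never exceeds |x|(bound + 1) + |w|, and there is one round per letter. -/
lemma detYields_before_aux (x : List A) (s : T.S) (w : List M.Γ) (hw : ∀ g ∈ w, g ≠ default) :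
    ∃ k ≤ x.length * (2 * (x.length * (T.bound + 1) + w.length) + 3) + 2,
      (before M T ends s₀ ι hι).DetYields k
        ⟨Stage.read s, Tape.mk₂ [] (x.map (letter M T ends s₀ ι hι) ++ w.map (inlMap M T ends s₀ ι hι))⟩
        (embed M T ends s₀ ι hι ⟨ends (T.run s x), Tape.mk₁ (w ++ T.output s x)⟩) := by
  induction x generalizing s w with
  | nil => exact ⟨2, by simp, by simpa [run, output] using detYields_finish s w⟩
  | cons a x ih =>
    have hb := T.length_emit_le s a
    obtain ⟨k, hk, h⟩ := ih (T.step s a) (w ++ T.emit s a) (by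
      intro g hg
      rcases List.mem_append.1 hg with h | h
      · exact hw g h
      · exact T.emit_ne_blank s a g h)
    have h₁ := detYields_letter (ends := ends) (s₀ := s₀) (hι := hι) s a
      (x.map (letter M T ends s₀ ι hι) ++ w.map (inlMap M T ends s₀ ι hι)) (by
        intro g hg
        rcases List.mem_append.1 hg with h | h
        · obtain ⟨b, -, rfl⟩ := List.mem_map.1 h
          exact Sum.inr_ne_inl
        · obtain ⟨b, hb, rfl⟩ := List.mem_map.1 h
          exact fun h => hw b hb (Sum.inl_injective h))
    refine ⟨_, ?_, h₁.trans (k := k) ?_⟩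
    · refine (Nat.add_le_add_left hk _).trans ?_
      simp only [List.length_append, List.length_map, List.length_cons]
      nlinarith
    · simpa [run, output] using h

/-- A bound for the running time of the preprocessing stage. -/
def timeBound (T : Transducer A M.Γ) : ℕ[X] := X * (2 * (X * (C T.bound + 1)) + 3) + 2

lemma detYields_before (x : List α) (s : T.S) :
    ∃ k ≤ (timeBound T).eval x.length,
      (before M T ends s₀ ι hι).DetYields k
        ⟨Stage.read s, Tape.mk₁ (x.map (before M T ends s₀ ι hι).inp)⟩
        (embed M T ends s₀ ι hι
          ⟨ends (T.run s (x.map ι)), Tape.mk₁ (T.output s (x.map ι))⟩) := by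
  obtain ⟨k, hk, h⟩ := detYields_before_aux (ends := ends) (s₀ := s₀) (hι := hι)
    (x.map ι) s [] (by simp)
  refine ⟨k, by simpa [timeBound] using hk, ?_⟩
  simp only [List.map_nil, List.append_nil, List.nil_append, List.map_map] at h
  exact h

end Run

/-- The halting computations of `before M T ends s₀ ι hι`. -/
lemma haltsIn_before (x : List α) {d : M.Cfg}
    (hd : d = ⟨ends (T.run s₀ (x.map ι)), Turing.Tape.mk₁ (T.output s₀ (x.map ι))⟩) :
    ∃ k₀ ≤ (timeBound T).eval x.length,
      (∀ k c, M.Yields k d c → c.state = M.final →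
        (before M T ends s₀ ι hι).HaltsIn x (k₀ + k) (embed M T ends s₀ ι hι c)) ∧
      (∀ k c, (before M T ends s₀ ι hι).Yields k ((before M T ends s₀ ι hι).init x) c →
        (k < k₀ ∧ c.state ≠ (before M T ends s₀ ι hι).final) ∨
        ∃ j e, k = k₀ + j ∧ M.Yields j d e ∧ c = embed M T ends s₀ ι hι e) := by
  subst hd
  obtain ⟨k₀, hk₀, h⟩ := detYields_before (ends := ends) (s₀ := s₀) (hι := hι) x s₀
  refine ⟨k₀, hk₀, fun k c hc hf => ⟨h.yields_add ((yields_embed_iff _ _ _).2 ⟨c, hc, rfl⟩),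
    (embed_state_eq_final_iff c).2 hf⟩, fun k c hc => ?_⟩
  rcases h.of_yields hc with h | ⟨j, rfl, hj⟩
  · exact Or.inl h
  · obtain ⟨e, he, rfl⟩ := (yields_embed_iff _ _ _).1 hj
    exact Or.inr ⟨j, e, rfl, he, rfl⟩

end Before

end Transducer

/-! ### Order preserving block codes -/

lemma List.lt_iff_lt_of_length_eq {β : Type*} [LinearOrder β] {u v x y : List β}
    (h : u.length = v.length) : u ++ x < v ++ y ↔ u < v ∨ (u = v ∧ x < y) := by
  induction u generalizing v with
  | nil => cases v <;> simp_all
  | cons a u ih =>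
    cases v with
    | nil => simp at h
    | cons b v =>
      simp only [List.cons_append, List.cons_lt_cons_iff, ih (Nat.succ.inj h), List.cons.injEq]
      tauto

lemma List.not_lt_replicate_true (l : List Bool) : ¬ List.replicate l.length true < l := by
  induction l with
  | nil => simp
  | cons b l ih => 
    simp only [List.length_cons, List.replicate_succ, List.cons_lt_cons_iff, not_or, not_and]
    exact ⟨by cases b <;> decide, fun _ => ih⟩

/-- An order preserving code for the letters of `α` by words of length `size` over `{0, 1}`,
together with the map `rd` that rounds a word up to (the letter of) the next code word. -/
structure BlockCode (α : Type*) [LinearOrder α] where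
  size : ℕ
  size_pos : 0 < size
  enc : α → List Bool
  length_enc : ∀ a, (enc a).length = size
  enc_lt_iff : ∀ a b, enc a < enc b ↔ a < b
  rd : List Bool → α
  enc_lt_iff_lt_rd : ∀ a b, b.length = size → (enc a < b ↔ a < rd b)
  bot : α
  bot_le : ∀ a, bot ≤ a

/-- With c letters, the unary code sends the i-th letter to 0^(c-1-i) 1^(i+1). The largest letter
gets 1^c, so every block can be rounded up to a code word. -/
theorem exists_blockCode (α : Type*) [Finite α] [LinearOrder α] [Nonempty α] :
    Nonempty (BlockCode α) := by
  classical
  have := Fintype.ofFinite α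
  set c := Fintype.card α with hc
  have hpos : 0 < c := Fintype.card_pos
  let e : α ≃o Fin c := (Fintype.orderIsoFinOfCardEq α rfl).symm
  let enc : α → List Bool := fun a =>
    List.replicate (c - 1 - e a) false ++ List.replicate (e a + 1) true
  have hlen : ∀ a, (enc a).length = c := fun a => by
    have := (e a).2
    simp only [enc, List.length_append, List.length_replicate]
    omega
  have hmono : StrictMono enc := fun a b hab => by
    have h : (e a : ℕ) < e b := e.strictMono hab
    have hb := (e b).2
    -- The two codes share their first c - 1 - `e b` zeros; in the next place the smaller letter has
    -- 0 and the larger one has 1.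
    have h₁ : c - 1 - (e a : ℕ) = (c - 1 - e b) + ((e b - e a - 1) + 1) := by omega
    simp only [enc]
    rw [h₁, List.replicate_add, List.append_assoc]
    apply List.append_left_lt
    rw [List.replicate_succ, List.replicate_succ (n := (e b : ℕ)), List.cons_append,
      List.cons_lt_cons_iff]
    exact Or.inl (by decide)
  have hex : ∀ b : List Bool, b.length = c → ∃ a, ¬ enc a < b := fun b hb => by
    refine ⟨e.symm ⟨c - 1, by omega⟩, ?_⟩
    have : enc (e.symm ⟨c - 1, by omega⟩) = List.replicate b.length true := by
      simp only [enc, OrderIso.apply_symm_apply, Nat.sub_self, List.replicate_zero,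
        List.nil_append, hb, Nat.sub_add_cancel hpos]
    rw [this]
    exact List.not_lt_replicate_true b
  have hrd : ∀ b : List Bool, ∃ r, b.length = c → ∀ a, enc a < b ↔ a < r := fun b => by
    by_cases hb : b.length = c
    -- The rounded letter is the least one whose code is not below `b`.
    · obtain ⟨r, hr, hmin⟩ := WellFounded.has_min (wellFounded_lt (α := α)) {a | ¬ enc a < b}
        (hex b hb)
      refine ⟨r, fun _ a => ⟨fun h => ?_, fun h => ?_⟩⟩
      · by_contra hra
        exact hr ((hmono.monotone (not_lt.1 hra)).trans_lt h)
      · by_contra ha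
        exact hmin a ha h
    · exact ⟨Classical.arbitrary α, fun h => absurd h hb⟩
  choose rd hrd using hrd
  exact ⟨{
    size := c
    size_pos := hpos
    enc := enc
    length_enc := hlen
    enc_lt_iff := fun a b => hmono.lt_iff_lt
    rd := rd
    enc_lt_iff_lt_rd := fun a b hb => hrd b hb a
    bot := e.symm ⟨0, hpos⟩
    bot_le := fun a => by rw [OrderIso.symm_apply_le]; exact Nat.zero_le _ }⟩

namespace BlockCode

variable {α : Type*} [LinearOrder α] (K : BlockCode α)

lemma rd_enc (a : α) : K.rd (K.enc a) = a := by
  refine eq_of_forall_lt_iff fun b => ?_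
  rw [← K.enc_lt_iff_lt_rd _ _ (K.length_enc a), K.enc_lt_iff]

/-- The letter-by-letter encoding. -/
def encode (x : List α) : List Bool := x.flatMap K.enc

lemma length_encode (x : List α) : (K.encode x).length = K.size * x.length := by
  induction x with
  | nil => rfl
  | cons a x ih =>
    simp only [encode, List.flatMap_cons, List.length_append, K.length_enc, List.length_cons] at *
    rw [ih]
    ring

/-- The state of the rounding transducer: whether all blocks read so far are code words, and the
part of the current block which has been read. -/
abbrev RState : Type := Bool × {l : List Bool // l.length < K.size}

open Classical in
/-- The transitions of the rounding transducer. -/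
def roundStep (s : K.RState) (b : Bool) : K.RState × Option α :=
  if h : (s.2.1 ++ [b]).length < K.size then ((s.1, ⟨s.2.1 ++ [b], h⟩), none)
  else ((s.1 && decide (s.2.1 ++ [b] = K.enc (K.rd (s.2.1 ++ [b]))), ⟨[], K.size_pos⟩),
    some (if s.1 then K.rd (s.2.1 ++ [b]) else K.bot))

/-- The output of the rounding transducer. -/
def roundFrom : K.RState → List Bool → List α
  | _, [] => []
  | s, b :: y => (K.roundStep s b).2.toList ++ roundFrom (K.roundStep s b).1 y

/-- The rounding map: for a word `y` of length `K.size * n`, this is the least word `x` of length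
`n` such that `y ≤ K.encode x`. -/
def round (y : List Bool) : List α := K.roundFrom (true, ⟨[], K.size_pos⟩) y

open Classical in
lemma roundFrom_block_aux (fl : Bool) (l b y : List Bool) (hl : l.length < K.size)
    (h : (l ++ b).length = K.size) :
    K.roundFrom (fl, ⟨l, hl⟩) (b ++ y) =
      (if fl then K.rd (l ++ b) else K.bot) ::
        K.roundFrom (fl && decide (l ++ b = K.enc (K.rd (l ++ b))), ⟨[], K.size_pos⟩) y := by
  induction b generalizing l with
  | nil => simp at h; omega
  | cons a b ih =>
    rw [List.cons_append, roundFrom]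
    by_cases h' : (l ++ [a]).length < K.size
    · have := ih (l ++ [a]) h' (by simpa using h)
      have hs : K.roundStep (fl, ⟨l, hl⟩) a = ((fl, ⟨l ++ [a], h'⟩), none) := dif_pos h'
      simpa [hs] using this
    · have hb : b = [] := by
        simp at h h'
        exact List.length_eq_zero_iff.1 (by omega)
      subst hb
      simp only [roundStep, h', dite_false]
      simp

-- If `b` is not a code word, then `b` lies strictly below the code of `K.rd b`; any continuation
-- then encodes above `y`, and the least one consists of bottom letters. This is what the flag
-- records.
open Classical in
lemma roundFrom_block (fl : Bool) (b y : List Bool) (h : b.length = K.size) :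
    K.roundFrom (fl, ⟨[], K.size_pos⟩) (b ++ y) =
      (if fl then K.rd b else K.bot) ::
        K.roundFrom (fl && decide (b = K.enc (K.rd b)), ⟨[], K.size_pos⟩) y := by
  simpa using K.roundFrom_block_aux fl [] b y K.size_pos (by simpa using h)

lemma exists_block {y : List Bool} {n : ℕ} (h : y.length = K.size * (n + 1)) :
    ∃ b y', y = b ++ y' ∧ b.length = K.size ∧ y'.length = K.size * n := by
  refine ⟨y.take K.size, y.drop K.size, (List.take_append_drop _ _).symm, ?_, ?_⟩
  · rw [List.length_take, h]
    exact min_eq_left (Nat.le_mul_of_pos_right _ n.succ_pos)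
  · rw [List.length_drop, h, mul_add, mul_one, Nat.add_sub_cancel]

lemma roundFrom_false {y : List Bool} {n : ℕ} (h : y.length = K.size * n) :
    K.roundFrom (false, ⟨[], K.size_pos⟩) y = List.replicate n K.bot := by
  induction n generalizing y with
  | zero =>
    rw [mul_zero] at h
    rw [List.length_eq_zero_iff.1 h]
    rfl
  | succ n ih =>
    obtain ⟨b, y', rfl, hb, hy'⟩ := K.exists_block h
    simp [roundFrom_block, hb, ih hy', List.replicate_succ]

lemma length_round {y : List Bool} {n : ℕ} (h : y.length = K.size * n) :
    (K.round y).length = n := by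
  classical
  induction n generalizing y with
  | zero =>
    rw [mul_zero] at h
    rw [List.length_eq_zero_iff.1 h]
    rfl
  | succ n ih =>
    obtain ⟨b, y', rfl, hb, hy'⟩ := K.exists_block h
    rw [round, roundFrom_block _ _ _ _ hb, List.length_cons]
    by_cases h : b = K.enc (K.rd b)
    · simp only [← h, decide_true, Bool.and_true, Nat.add_right_cancel_iff]
      exact ih hy'
    · simp [h, K.roundFrom_false hy']

lemma round_encode (x : List α) : K.round (K.encode x) = x := by
  induction x with
  | nil => rfl
  | cons a x ih =>
    rw [round, encode, List.flatMap_cons, roundFrom_block _ _ _ _ (K.length_enc a), K.rd_enc]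
    simp only [if_true, decide_true, Bool.and_true]
    exact congrArg _ ih

lemma encode_injective : Function.Injective K.encode :=
  Function.LeftInverse.injective K.round_encode

lemma not_lt_replicate_bot (x : List α) : ¬ x < List.replicate x.length K.bot := by
  induction x with
  | nil => simp
  | cons a x ih =>
    simp only [List.length_cons, List.replicate_succ, List.cons_lt_cons_iff, not_or, not_and]
    exact ⟨(K.bot_le a).not_gt, fun _ => ih⟩

/-- Encoding and rounding form a Galois connection at each length. Blockwise, a strict comparison is
decided by `K.rd`; in case of a tie the tails are compared. -/
lemma encode_lt_iff (x : List α) (y : List Bool) (h : y.length = K.size * x.length) :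
    K.encode x < y ↔ x < K.round y := by
  classical
  induction x generalizing y with
  | nil =>
    rw [List.length_nil, mul_zero] at h
    rw [List.length_eq_zero_iff.1 h]
    exact ⟨fun h => absurd h (by simp [encode]), fun h => absurd h (by simp [round, roundFrom])⟩
  | cons a x ih =>
    obtain ⟨b, y', rfl, hb, hy'⟩ := K.exists_block h
    rw [round, roundFrom_block _ _ _ _ hb, encode, List.flatMap_cons,
      List.lt_iff_lt_of_length_eq ((K.length_enc a).trans hb.symm), K.enc_lt_iff_lt_rd a b hb,
      List.cons_lt_cons_iff]
    simp only [if_true, Bool.true_and]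
    refine or_congr Iff.rfl ?_
    by_cases h : b = K.enc (K.rd b)
    · simp only [← h, decide_true]
      refine and_congr ⟨fun h' => ?_, fun h' => ?_⟩ (ih y' hy')
      · rw [← h', K.rd_enc]
      · rw [h', ← h]
    -- Both sides of the tie case fail: the block is not a code word, and nothing lies below a word
    -- of bottom letters.
    · simp only [h, decide_false, K.roundFrom_false hy', K.not_lt_replicate_bot, and_false,
        iff_false, not_and]
      rintro rfl
      exact absurd (by rw [K.rd_enc]) h

end BlockCode

/-! ### The transducers -/

section Transducers

variable {α : Type*} [LinearOrder α]

/-- The transducer which computes `K.encode`, on the letters written as elements of `A`. -/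
def encodeTransducer (K : BlockCode α) {A Γ : Type} [Inhabited Γ] (e : A → α) (bit : Bool → Γ)
    (hbit : ∀ b, bit b ≠ default) : Transducer A Γ where
  S := Unit
  step _ _ := ()
  emit _ a := (K.enc (e a)).map bit
  bound := K.size
  length_emit_le _ a := by simp [K.length_enc]
  emit_ne_blank _ a g hg := by
    obtain ⟨b, -, rfl⟩ := List.mem_map.1 hg
    exact hbit b

lemma encodeTransducer_output (K : BlockCode α) {A Γ : Type} [Inhabited Γ] (e : A → α)
    (bit : Bool → Γ) (hbit : ∀ b, bit b ≠ default) (x : List A) :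
    (encodeTransducer K e bit hbit).output () x = (K.encode (x.map e)).map bit := by
  induction x with
  | nil => rfl
  | cons a x ih =>
    refine (Transducer.output_cons _ _ _ _).trans ((congrArg _ ih).trans ?_)
    simp only [BlockCode.encode, List.map_cons, List.flatMap_cons, List.map_append]
    rfl

/-- The transducer which copies its input and counts the letters `some b` modulo `m`. -/
def countTransducer (m : ℕ) (hm : 0 < m) {A Γ : Type} [Inhabited Γ] (lett : Option A → Γ)
    (hlett : ∀ a, lett a ≠ default) : Transducer (Option A) Γ where
  S := Fin m
  step i a := match a with
    | none => i
    | some _ => ⟨(i + 1) % m, Nat.mod_lt _ hm⟩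
  emit _ a := [lett a]
  bound := 1
  length_emit_le _ _ := le_rfl
  emit_ne_blank _ a g hg := by
    rw [List.mem_singleton.1 hg]
    exact hlett a

lemma countTransducer_output {m : ℕ} (hm : 0 < m) {A Γ : Type} [Inhabited Γ]
    (lett : Option A → Γ) (hlett : ∀ a, lett a ≠ default) (i : Fin m) (x : List (Option A)) :
    (countTransducer m hm lett hlett).output i x = x.map lett := by
  induction x generalizing i with
  | nil => rfl
  | cons a x ih =>
    exact congrArg (lett a :: ·) (ih _)

lemma countTransducer_run {m : ℕ} (hm : 0 < m) {A Γ : Type} [Inhabited Γ]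
    (lett : Option A → Γ) (hlett : ∀ a, lett a ≠ default) (i : Fin m) (x : List A) (k : ℕ) :
    ((countTransducer m hm lett hlett).run i (encodePair x k) : Fin m) =
      ⟨(i + x.length) % m, Nat.mod_lt _ hm⟩ := by
  induction x generalizing i with
  | nil =>
    have : (countTransducer m hm lett hlett).run i (List.replicate k none) = i := by
      induction k with
      | zero => rfl
      | succ k ih => exact ih
    simp only [encodePair, List.map_nil, List.nil_append, this]
    exact Fin.ext (Nat.mod_eq_of_lt i.2).symm
  | cons a x ih =>
    refine (ih ⟨(i + 1) % m, Nat.mod_lt _ hm⟩).trans (Fin.ext ?_)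
    simp only [Nat.mod_add_mod, List.length_cons]
    congr 1
    ring

/-- The transducer which, started in a state `inl s`, rounds its input (and copies the letters
`none`), and, started in the state `inr false`, prefixes its input by `0` (and drops the
letters `none`). -/
def roundTransducer (K : BlockCode α) {Γ : Type} [Inhabited Γ] (lett : Option α → Γ)
    (hlett : ∀ a, lett a ≠ default) (bit : Bool → Γ) (hbit : ∀ b, bit b ≠ default) :
    Transducer (Option Bool) Γ where
  S := K.RState ⊕ Bool
  finiteS := by
    have : Finite {l : List Bool // l.length < K.size} :=
      (List.finite_length_lt Bool K.size).to_subtype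
    infer_instance
  step
    | .inl s, some b => .inl (K.roundStep s b).1
    | .inl s, none => .inl s
    | .inr _, some _ => .inr true
    | .inr i, none => .inr i
  emit
    | .inl s, some b => ((K.roundStep s b).2.map fun a => lett (some a)).toList
    | .inl _, none => [lett none]
    | .inr false, some b => [bit false, bit b]
    | .inr true, some b => [bit b]
    | .inr _, none => []
  bound := 2
  length_emit_le s a := by
    rcases s with s | (_ | _) <;> rcases a with _ | b <;> simp
    exact (Option.length_toList_le).trans one_le_two
  emit_ne_blank s a g hg := by
    rcases s with s | (_ | _) <;> rcases a with _ | b <;> simp at hg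
    · rw [hg]; exact hlett _
    · obtain ⟨a, -, rfl⟩ := hg; exact hlett _
    · rcases hg with rfl | rfl <;> exact hbit _
    · rw [hg]; exact hbit _

section Round

variable (K : BlockCode α) {Γ : Type} [Inhabited Γ] {lett : Option α → Γ}
    (hlett : ∀ a, lett a ≠ default) {bit : Bool → Γ} (hbit : ∀ b, bit b ≠ default)

lemma roundTransducer_output_inl (s : K.RState) (y : List Bool) (k : ℕ) :
    (roundTransducer K lett hlett bit hbit).output (.inl s) (encodePair y k) =
      (encodePair (K.roundFrom s y) k).map lett := by
  induction y generalizing s with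
  | nil =>
    simp only [encodePair, List.map_nil, List.nil_append, BlockCode.roundFrom]
    induction k with
    | zero => rfl
    | succ k ih =>
      exact congrArg (lett none :: ·) ih
  | cons b y ih =>
    refine (Transducer.output_cons _ _ _ _).trans
      ((congrArg _ (ih (K.roundStep s b).1)).trans ?_)
    simp only [encodePair, BlockCode.roundFrom, List.map_append, List.append_assoc]
    refine congrArg (· ++ _) ?_
    change ((K.roundStep s b).2.map fun a => lett (some a)).toList = _
    cases (K.roundStep s b).2 <;> rfl

/-- Only the summand of the final state matters: it decides whether the next machine is started or
stopped at once. -/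
lemma roundTransducer_run_inl (s : K.RState) (x : List (Option Bool)) :
    ∃ s', (roundTransducer K lett hlett bit hbit).run (.inl s) x = .inl s' := by
  induction x generalizing s with
  | nil => exact ⟨s, rfl⟩
  | cons a x ih =>
    cases a with
    | none => exact ih s
    | some b => exact ih (K.roundStep s b).1

lemma roundTransducer_run_inr (i : Bool) (x : List (Option Bool)) :
    ∃ i', (roundTransducer K lett hlett bit hbit).run (.inr i) x = .inr i' := by
  induction x generalizing i with
  | nil => exact ⟨i, rfl⟩
  | cons a x ih =>
    cases a with
    | none => exact ih i
    | some b => exact ih true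

lemma roundTransducer_output_inr_true (y : List Bool) (k : ℕ) :
    (roundTransducer K lett hlett bit hbit).output (.inr true) (encodePair y k) = y.map bit := by
  induction y with
  | nil =>
    simp only [encodePair, List.map_nil, List.nil_append]
    induction k with
    | zero => rfl
    | succ k ih => exact ih
  | cons b y ih => exact congrArg (bit b :: ·) ih

/-- The additional 0 is emitted together with the first letter, so the empty word must be excluded;
its length is divisible by the block size and it is never treated in this mode. -/
lemma roundTransducer_output_inr_false (y : List Bool) (hy : y ≠ []) (k : ℕ) :
    (roundTransducer K lett hlett bit hbit).output (.inr false) (encodePair y k) =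
      (false :: y).map bit := by
  cases y with
  | nil => exact absurd rfl hy
  | cons b y =>
    exact congrArg (fun l => bit false :: bit b :: l)
      (roundTransducer_output_inr_true K hlett hbit y k)

end Round

end Transducers

/-! ### Masses -/

section Mass

variable {α : Type*}

lemma finite_words [Finite α] (n : ℕ) (S : Set (List α)) : {x : List α | x.length = n ∧ x ∈ S}.Finite :=
  (List.finite_length_eq α n).subset fun _ h => h.1

lemma mass_nonneg {μ : List α → ℝ} (hμ : ∀ x, 0 ≤ μ x) (n : ℕ) (S : Set (List α)) :
    0 ≤ mass μ n S :=
  finsum_nonneg fun x => finsum_nonneg fun _ => hμ x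

lemma mass_mono [Finite α] {μ : List α → ℝ} (hμ : ∀ x, 0 ≤ μ x) (n : ℕ) {S S' : Set (List α)}
    (h : S ⊆ S') : mass μ n S ≤ mass μ n S' := by
  unfold mass
  rw [finsum_mem_eq_finite_toFinset_sum _ (finite_words n S),
    finsum_mem_eq_finite_toFinset_sum _ (finite_words n S')]
  refine Finset.sum_le_sum_of_subset_of_nonneg ?_ fun x _ _ => hμ x
  exact Set.Finite.toFinset_subset_toFinset.2 fun x hx => ⟨hx.1, h hx.2⟩

lemma mass_congr {μ : List α → ℝ} (n : ℕ) {S S' : Set (List α)}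
    (h : ∀ x, x.length = n → (x ∈ S ↔ x ∈ S')) : mass μ n S = mass μ n S' := by
  have : {x : List α | x.length = n ∧ x ∈ S} = {x | x.length = n ∧ x ∈ S'} :=
    Set.ext fun x => and_congr_right (h x)
  rw [mass, mass, this]

lemma mass_of_const [Finite α] {μ : List α → ℝ} {n : ℕ} {r : ℝ} (h : ∀ x, x.length = n → μ x = r)
    (S : Set (List α)) : mass μ n S = {x : List α | x.length = n ∧ x ∈ S}.ncard * r := by
  rw [mass, finsum_mem_congr rfl fun x hx => h x hx.1,
    finsum_mem_eq_finite_toFinset_sum _ (finite_words n S), Finset.sum_const, nsmul_eq_mul,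
    Set.ncard_eq_toFinset_card _ (finite_words n S)]

end Mass

lemma ncard_words (n : ℕ) : {y : List Bool | y.length = n ∧ y ∈ Set.univ}.ncard = 2 ^ n := by
  have : {y : List Bool | y.length = n ∧ y ∈ Set.univ} = {y | y.length = n} := by simp
  rw [this, ← Nat.card_coe_set_eq]
  change Nat.card (List.Vector Bool n) = _
  rw [Nat.card_eq_fintype_card, card_vector, Fintype.card_bool]

/-- The words below 1y are all the 0z, and the 1z with z < y; below 0y there are only the 0z with z
< y. The leading `false` is the integer digit of the fraction 0.y. -/
lemma ncard_words_lt (y : List Bool) :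
    ({z : List Bool | z.length = y.length ∧ z ∈ {z | z < y}}.ncard : ℝ) * (2 ^ y.length)⁻¹ =
      binaryFraction (false :: y) := by
  induction y with
  | nil => simp [binaryFraction]
  | cons b y ih =>
    have hfin : ∀ S : Set (List Bool), {z : List Bool | z.length = y.length ∧ z ∈ S}.Finite :=
      fun S => finite_words _ S
    have hinj : ∀ b : Bool, Function.Injective (List.cons b) := fun b => List.cons_injective
    have ih' : ({z : List Bool | z.length = y.length ∧ z ∈ {z | z < y}}.ncard : ℝ) =
        2 ^ y.length * binaryFraction (false :: y) := by
      rw [← ih]; field_simp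
    cases b with
    | false =>
      have : {z : List Bool | z.length = (false :: y).length ∧ z ∈ {z | z < false :: y}} =
          List.cons false '' {z | z.length = y.length ∧ z ∈ {z | z < y}} := by
        ext z
        rcases z with _ | ⟨_ | _, z⟩ <;> simp [List.cons_lt_cons_iff, -not_lt, Bool.lt_iff]
      rw [this, Set.ncard_image_of_injective _ (hinj false), ih']
      simp [binaryFraction, pow_succ]
      field_simp
    | true =>
      have : {z : List Bool | z.length = (true :: y).length ∧ z ∈ {z | z < true :: y}} =
          List.cons false '' {z | z.length = y.length ∧ z ∈ Set.univ} ∪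
          List.cons true '' {z | z.length = y.length ∧ z ∈ {z | z < y}} := by
        ext z
        rcases z with _ | ⟨_ | _, z⟩ <;> simp [List.cons_lt_cons_iff, -not_lt]
      rw [this, Set.ncard_union_eq ?_ ((hfin _).image _) ((hfin _).image _),
        Set.ncard_image_of_injective _ (hinj false), Set.ncard_image_of_injective _ (hinj true),
        ncard_words, Nat.cast_add, ih']
      · simp [binaryFraction, pow_succ]
        field_simp
      · rw [Set.disjoint_left]
        rintro _ ⟨z, -, rfl⟩ ⟨z', -, h⟩
        simp at h

/-! ### The binary problem -/

section Target

variable {α : Type*} [LinearOrder α] (K : BlockCode α) (D : DistProblem α)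

open Classical in
/-- The transfer of `D.μ` along `K.encode`. -/
def targetMeasure (y : List Bool) : ℝ :=
  if K.size ∣ y.length then (if K.encode (K.round y) = y then D.μ (K.round y) else 0)
  else (2 ^ y.length)⁻¹

lemma targetMeasure_encode (x : List α) : targetMeasure K D (K.encode x) = D.μ x := by
  rw [targetMeasure, if_pos (by rw [K.length_encode]; exact dvd_mul_right _ _), K.round_encode,
    if_pos rfl]

/-- At these lengths the measure is supported on code words, and `K.encode` is injective, so the sum
can be reindexed. -/
lemma mass_targetMeasure (n : ℕ) (S : Set (List Bool)) :
    mass (targetMeasure K D) (K.size * n) S = mass D.μ n {x | K.encode x ∈ S} := by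
  have h₁ : mass D.μ n {x | K.encode x ∈ S} =
      ∑ᶠ y ∈ K.encode '' {x | x.length = n ∧ K.encode x ∈ S}, targetMeasure K D y := by
    rw [finsum_mem_image K.encode_injective.injOn]
    exact finsum_mem_congr rfl fun x _ => (targetMeasure_encode K D x).symm
  rw [h₁, mass]
  refine finsum_mem_inter_support_eq (targetMeasure K D) _ _ ?_
  ext y
  simp only [Set.mem_inter_iff, Set.mem_ofPred_eq, Set.mem_image, Function.mem_support]
  refine and_congr_left fun hy => ⟨fun ⟨hl, hS⟩ => ?_, ?_⟩
  · have he : K.encode (K.round y) = y := by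
      by_contra hne
      exact hy (by rw [targetMeasure, if_pos (hl ▸ dvd_mul_right _ _), if_neg hne])
    exact ⟨K.round y, ⟨K.length_round hl, he.symm ▸ hS⟩, he⟩
  · rintro ⟨x, ⟨rfl, hS⟩, rfl⟩
    exact ⟨K.length_encode x, hS⟩

lemma mass_targetMeasure_of_not_dvd {n : ℕ} (hn : ¬ K.size ∣ n) (S : Set (List Bool)) :
    mass (targetMeasure K D) n S =
      {y : List Bool | y.length = n ∧ y ∈ S}.ncard * ((2 : ℝ) ^ n)⁻¹ := by
  refine mass_of_const (fun y hy => ?_) S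
  subst hy
  exact if_neg hn

/-- The binary distributional problem to which `D` is reduced by `K.encode`. -/
def target : DistProblem Bool where
  -- On words that are not codes the choice is immaterial for the reduction; this one lets NP
  -- membership be inherited through rounding.
  pos := {y | K.round y ∈ D.pos}
  μ := targetMeasure K D
  nonneg y := by
    unfold targetMeasure
    split_ifs
    exacts [D.nonneg _, le_rfl, by positivity]
  total n := by
    by_cases hn : K.size ∣ n
    · obtain ⟨m, rfl⟩ := hn
      rw [mass_targetMeasure, ← D.total m]
      exact mass_congr m fun x _ => by simp
    · rw [mass_targetMeasure_of_not_dvd K D hn, ncard_words]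
      push_cast
      exact mul_inv_cancel₀ (by positivity)

lemma distribution_target_of_dvd {y : List Bool} (h : K.size ∣ y.length) :
    distribution (target K D).μ y = distribution D.μ (K.round y) := by
  obtain ⟨n, hn⟩ := h
  rw [distribution, distribution, hn, K.length_round hn]
  refine (mass_targetMeasure K D n _).trans (mass_congr n fun x hx => ?_)
  subst hx
  exact K.encode_lt_iff x y hn

lemma distribution_target_of_not_dvd {y : List Bool} (h : ¬ K.size ∣ y.length) :
    distribution (target K D).μ y = binaryFraction (false :: y) := by
  rw [← ncard_words_lt y]
  exact mass_targetMeasure_of_not_dvd K D h _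

/-- Fibres of `K.encode` have at most one element, namely `K.round y`. The lengths attained are
exactly the multiples of the block size, since there is a letter to repeat. -/
lemma isTransfer_encode : IsTransfer K.encode D.μ (target K D).μ := by
  intro y
  change targetMeasure K D y = _
  by_cases h : K.size ∣ y.length
  · rw [if_pos]
    · by_cases he : K.encode (K.round y) = y
      · have : {x | K.encode x = y} = {K.round y} := by
          ext x
          exact ⟨fun hx => by rw [← hx, K.round_encode]; rfl, fun hx => by rw [hx]; exact he⟩
        rw [this, finsum_mem_singleton, targetMeasure, if_pos h, if_pos he]
      · have : {x | K.encode x = y} = ∅ := by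
          ext x
          simp only [Set.mem_ofPred_eq, Set.mem_empty_iff_false, iff_false]
          rintro rfl
          exact he (by rw [K.round_encode])
        rw [this, finsum_mem_empty, targetMeasure, if_pos h, if_neg he]
    · obtain ⟨n, hn⟩ := h
      exact ⟨List.replicate n K.bot, by rw [hn, K.length_encode, List.length_replicate]⟩
  · rw [if_neg, targetMeasure, if_neg h]
    · simp
    · rintro ⟨z, hz⟩
      exact h (by rw [hz, K.length_encode]; exact dvd_mul_right _ _)

end Target

/-! ### Compositions decide strongly generically -/

namespace TM

variable {α β : Type*}

/-- A finite infimum in ℕ∞ is attained. -/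
lemma runTime_le_iff (M : TM α Bool) (x : List α) (t : ℕ) :
    M.runTime x ≤ t ↔ ∃ k ≤ t, ∃ c, M.HaltsIn x k c ∧ (M.Answers c .yes ∨ M.Answers c .no) := by
  constructor
  · intro h
    rcases Set.eq_empty_or_nonempty {t : ℕ∞ | ∃ (k : ℕ) (c : M.Cfg), t = k ∧ M.HaltsIn x k c ∧
      (M.Answers c .yes ∨ M.Answers c .no)} with he | hne
    · rw [runTime, he, sInf_empty] at h
      exact absurd (top_le_iff.1 h) (ENat.natCast_ne_top t)
    · obtain ⟨k, c, hk, hc⟩ := csInf_mem hne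
      rw [runTime, hk] at h
      exact ⟨k, by exact_mod_cast h, c, hc⟩
  · rintro ⟨k, hk, c, hc⟩
    refine (show M.runTime x ≤ k from sInf_le ⟨k, c, rfl, hc⟩).trans ?_
    exact_mod_cast hk

end TM

lemma eval_mono (p : ℕ[X]) {m n : ℕ} (h : m ≤ n) : p.eval m ≤ p.eval n := by
  rw [Polynomial.eval_eq_sum, Polynomial.eval_eq_sum]
  exact Finset.sum_le_sum fun i _ => Nat.mul_le_mul_left _ (Nat.pow_le_pow_left h i)

theorem sgpDecides_of_isComposition {α : Type*} [Finite α] [LinearOrder α] (K : BlockCode α)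
    (D : DistProblem α) {M : TM Bool Bool} (hM : SGPDecides M (target K D)) {P : TM α Bool}
    (hP : P.IsComposition M K.encode) : SGPDecides P D := by
  obtain ⟨-, hdec, p, hp⟩ := hM
  obtain ⟨hdet, r, hr⟩ := hP
  -- The time of `M` on an input of length c·n, plus the overhead of the composition.
  refine ⟨hdet, fun x k c hc => ?_, p.comp (C K.size * X) + r, fun q hq => ?_⟩
  · obtain ⟨k', c', hc', ha⟩ := (hr x).2 k c hc
    have hx : K.encode x ∈ (target K D).pos ↔ x ∈ D.pos := by
      change K.round (K.encode x) ∈ D.pos ↔ _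
      rw [K.round_encode]
    simpa only [ha, hx] using hdec _ k' c' hc'
  · have hs : (K.size : ℝ) ≠ 0 := by exact_mod_cast K.size_pos.ne'
    -- q'(X) = q(X/c), so that the estimate for q' at length c·n is the one for q at n.
    set q' : ℝ[X] := q.comp (C (K.size : ℝ)⁻¹ * X) with hq'
    have hcomp : q'.comp (C (K.size : ℝ) * X) = q := by
      rw [hq', Polynomial.comp_assoc]
      have : (C (K.size : ℝ)⁻¹ * X : ℝ[X]).comp (C (K.size : ℝ) * X) = X := by
        rw [mul_comp, C_comp, X_comp, ← mul_assoc, ← C_mul, inv_mul_cancel₀ hs, C_1, one_mul]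
      rw [this, comp_X]
    have hq0 : q' ≠ 0 := by
      intro h
      rw [h, zero_comp] at hcomp
      exact hq hcomp.symm
    have htend : Filter.Tendsto (fun n : ℕ => K.size * n) Filter.atTop Filter.atTop :=
      Filter.tendsto_id.const_mul_atTop' K.size_pos
    have h := (hp q' hq0).comp_tendsto htend
    have hR : ((fun n : ℕ => 1 / q'.eval (n : ℝ)) ∘ fun n : ℕ => K.size * n) =
        fun n : ℕ => 1 / q.eval (n : ℝ) := by
      ext n
      conv_rhs => rw [← hcomp]
      simp [eval_comp]
    rw [hR] at h
    refine Asymptotics.IsBigO.trans_isLittleO (Asymptotics.IsBigO.of_bound 1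
      (Filter.Eventually.of_forall fun n => ?_)) h
    rw [one_mul, Real.norm_of_nonneg (mass_nonneg D.nonneg _ _), Function.comp_apply,
      Real.norm_of_nonneg (mass_nonneg (target K D).nonneg _ _)]
    -- A slow input of `P` is encoded by a slow input of `M`. The implication makes the inclusion
    -- trivial for words of other lengths, which do not contribute to the mass.
    refine le_trans (mass_mono (S' := {x | x.length = n → K.encode x ∈
      {y | ((p.eval (K.size * n) : ℕ) : ℕ∞) < M.runTime y}}) D.nonneg n ?_) (le_of_eq ?_)
    · rintro x hx rfl
      by_contra hlt
      obtain ⟨k, hk, c, hc, ha⟩ := (M.runTime_le_iff _ _).1 (not_lt.1 hlt)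
      obtain ⟨k', hk', c', hc', ha'⟩ := (hr x).1 k c hc
      refine absurd hx (not_lt.2 ((P.runTime_le_iff _ _).2 ⟨k', ?_, c', hc', ?_⟩))
      · simp only [eval_add, eval_comp, eval_mul, eval_C, eval_X]
        omega
      · simpa only [ha'] using ha
    · refine (mass_congr n fun x hx => ?_).trans (mass_targetMeasure K D n _).symm
      simp [hx]

/-! ### The machines -/

open Transducer

/-- A machine which stops at once. -/
def haltMachine : TM Bool Bool where
  Q := Unit
  Γ := Option Bool
  inp := some
  inp_injective := Option.some_injective _
  inp_ne_blank b := Option.some_ne_none b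
  out := some
  out_injective := Option.some_injective _
  out_ne_blank b := Option.some_ne_none b
  start := ()
  final := ()
  δ _ _ := {((), none, .right)}

/-! ### Machines that compute the code -/

section Encode

variable {α : Type*} [Finite α] [LinearOrder α] (K : BlockCode α)

/-- Every machine with binary input can be preceded by the computation of `K.encode`. -/
lemma exists_encode_before {γ : Type*} (M : TM Bool γ) :
    ∃ (A : Type) (_ : Finite A) (T : Transducer A M.Γ) (ends : T.S → M.Q) (s₀ : T.S)
      (ι : α → A), Function.Injective ι ∧ ∀ x : List α,
        M.init (K.encode x) =
          ⟨ends (T.run s₀ (x.map ι)), Turing.Tape.mk₁ (T.output s₀ (x.map ι))⟩ := by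
  obtain ⟨n, ⟨e⟩⟩ := Finite.exists_equiv_fin α
  refine ⟨Fin n, inferInstance, encodeTransducer K e.symm M.inp M.inp_ne_blank,
    fun _ => M.start, (), e, e.injective, fun x => ?_⟩
  rw [TM.init]
  refine congrArg _ (congrArg _ (Eq.trans ?_ (encodeTransducer_output K _ _ _ _).symm))
  simp

lemma exists_isComposition_encode (M : TM Bool Bool) (hM : M.Deterministic) :
    ∃ P : TM α Bool, P.IsComposition M K.encode := by
  obtain ⟨A, _, T, ends, s₀, ι, hι, hinit⟩ := exists_encode_before K M
  refine ⟨before M T ends s₀ ι hι, before_deterministic hM, timeBound T, fun x => ?_⟩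
  obtain ⟨k₀, hk₀, h₁, h₂⟩ := haltsIn_before (hι := hι) x (hinit x)
  refine ⟨fun k c hc => ⟨_, by omega, _, h₁ k c hc.1 hc.2, embed_answers_iff c⟩,
    fun k c hc => ?_⟩
  rcases h₂ k c hc.1 with h | ⟨j, e, rfl, he, rfl⟩
  · exact absurd hc.2 h.2
  · exact ⟨j, e, ⟨he, (embed_state_eq_final_iff e).1 hc.2⟩, embed_answers_iff e⟩

/-- The code is the word that the preprocessing stage leaves on the tape when the machine behind it
stops without a step. -/
lemma ptimeComputable_encode : PtimeComputable K.encode := by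
  obtain ⟨A, _, T, ends, s₀, ι, hι, hinit⟩ := exists_encode_before K haltMachine
  refine ⟨before haltMachine T ends s₀ ι hι,
    before_deterministic fun _ _ => ⟨_, rfl, fun _ h => h⟩, timeBound T, fun x => ?_⟩
  obtain ⟨k₀, hk₀, h₁, -⟩ := haltsIn_before (hι := hι) x (hinit x)
  exact ⟨_, hk₀, _, h₁ 0 _ rfl rfl, embed_outputs rfl⟩

end Encode

/-! ### Machines for the binary problem -/

section Target

variable {α : Type*} [LinearOrder α] (K : BlockCode α)

lemma BlockCode.length_roundFrom_le (s : K.RState) (y : List Bool) :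
    (K.roundFrom s y).length ≤ y.length := by
  induction y generalizing s with
  | nil => rfl
  | cons b y ih =>
    have h₁ := ih (K.roundStep s b).1
    have h₂ := Option.length_toList_le (o := (K.roundStep s b).2)
    rw [BlockCode.roundFrom, List.length_append, List.length_cons]
    omega

lemma inNP_round_preimage {L : Set (List α)} (hL : InNP L) : InNP {y | K.round y ∈ L} := by
  obtain ⟨M, p, hp, hM⟩ := hL
  -- The letter `none` does not occur here (k = 0), so any nonblank symbol may represent it.
  let lett : Option α → M.Γ := fun o => o.elim (M.out true) M.inp
  have hlett : ∀ o, lett o ≠ default := by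
    rintro (_ | a)
    exacts [M.out_ne_blank _, M.inp_ne_blank _]
  let T := roundTransducer K lett hlett M.out M.out_ne_blank
  let s₀ : T.S := .inl (true, ⟨[], K.size_pos⟩)
  have hinit : ∀ y : List Bool, M.init (K.round y) =
      ⟨M.start, Turing.Tape.mk₁ (T.output s₀ (y.map some))⟩ := fun y => by
    have := roundTransducer_output_inl K hlett M.out_ne_blank (true, ⟨[], K.size_pos⟩) y 0
    simp only [encodePair, List.replicate_zero, List.append_nil, List.map_map] at this
    exact congrArg (fun l => (⟨M.start, Turing.Tape.mk₁ l⟩ : M.Cfg)) this.symm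
  refine ⟨before M T (fun _ => M.start) s₀ some (Option.some_injective _), timeBound T + p,
    fun y k c hc => ?_, fun y => ?_⟩
  · obtain ⟨k₀, hk₀, -, h₂⟩ := haltsIn_before (T := T) (ends := fun _ => M.start) (s₀ := s₀)
      (hι := Option.some_injective _) y (hinit y)
    rw [eval_add]
    rcases h₂ k c hc with h | ⟨j, e, rfl, he, rfl⟩
    · omega
    · have h₁ := hp _ j e he
      -- Rounding does not lengthen words, and polynomials with natural coefficients are monotone.
      have h₂ := eval_mono p (K.length_roundFrom_le (true, ⟨[], K.size_pos⟩) y)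
      exact add_le_add hk₀ (h₁.trans h₂)
  · obtain ⟨k₀, hk₀, h₁, h₂⟩ := haltsIn_before (T := T) (ends := fun _ => M.start) (s₀ := s₀)
      (hι := Option.some_injective _) y (hinit y)
    refine (hM (K.round y)).trans ⟨?_, ?_⟩
    · rintro ⟨k, c, hc, ha⟩
      exact ⟨_, _, h₁ k c hc.1 hc.2, (embed_answers_iff c _).2 ha⟩
    · rintro ⟨k, c, hc, ha⟩
      rcases h₂ k c hc.1 with h | ⟨j, e, rfl, he, rfl⟩
      · exact absurd hc.2 h.2
      · exact ⟨j, e, ⟨he, (embed_state_eq_final_iff e).1 hc.2⟩, (embed_answers_iff e _).1 ha⟩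

lemma length_encodePair {β : Type*} (x : List β) (k : ℕ) :
    (encodePair x k).length = x.length + k := by
  simp [encodePair]

/-- Two preprocessing stages are nested. The outer one copies the input and finds its length modulo
the block size; the inner one then either rounds the word and starts `M`, or writes 0 in front of it
and stops. -/
lemma ptimeComputableReal_of_round {g : List α → ℝ} (hg : PtimeComputableReal g)
    {h : List Bool → ℝ} (h₁ : ∀ y, K.size ∣ y.length → h y = g (K.round y))
    (h₂ : ∀ y, ¬ K.size ∣ y.length → h y = binaryFraction (false :: y)) :
    PtimeComputableReal h := by
  obtain ⟨M, hdet, p, hp⟩ := hg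
  let T₂ := roundTransducer K M.inp M.inp_ne_blank M.out M.out_ne_blank
  -- In prefix mode `M` is entered in its final state, so the word on the tape is the output.
  let ends₂ : T₂.S → M.Q := Sum.elim (fun _ => M.start) fun _ => M.final
  let s₂ : T₂.S := .inr false
  let P₂ := before M T₂ ends₂ s₂ id Function.injective_id
  let T₁ := countTransducer K.size K.size_pos P₂.inp P₂.inp_ne_blank
  let mode : Fin K.size → T₂.S := fun i =>
    if (i : ℕ) = 0 then .inl (true, ⟨[], K.size_pos⟩) else .inr false
  let ends₁ : T₁.S → P₂.Q := fun i => Stage.read (mode i)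
  let s₁ : T₁.S := (⟨0, K.size_pos⟩ : Fin K.size)
  have key : ∀ (y : List Bool) (k : ℕ),
      ∃ t ≤ (timeBound T₁ + timeBound T₂).eval (y.length + k), ∀ j c,
        M.Yields j ⟨ends₂ (T₂.run (mode ⟨y.length % K.size, Nat.mod_lt _ K.size_pos⟩)
            (encodePair y k)),
          Turing.Tape.mk₁ (T₂.output (mode ⟨y.length % K.size, Nat.mod_lt _ K.size_pos⟩)
            (encodePair y k))⟩ c → c.state = M.final →
        (before P₂ T₁ ends₁ s₁ id Function.injective_id).HaltsIn (encodePair y k) (t + j)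
          (embed P₂ T₁ ends₁ s₁ id Function.injective_id
            (embed M T₂ ends₂ s₂ id Function.injective_id c)) := by
    intro y k
    have hrun : T₁.run s₁ ((encodePair y k).map id) =
        (⟨y.length % K.size, Nat.mod_lt _ K.size_pos⟩ : Fin K.size) := by
      rw [List.map_id]
      refine (countTransducer_run K.size_pos _ _ _ y k).trans (Fin.ext ?_)
      simp [s₁]
    have hout : T₁.output s₁ ((encodePair y k).map id) = (encodePair y k).map P₂.inp := by
      rw [List.map_id]
      exact countTransducer_output K.size_pos _ _ _ _
    obtain ⟨t₁, ht₁, hf₁, -⟩ := haltsIn_before (M := P₂) (T := T₁) (ends := ends₁) (s₀ := s₁)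
      (hι := Function.injective_id) (encodePair y k)
      (d := ⟨Stage.read (mode ⟨y.length % K.size, Nat.mod_lt _ K.size_pos⟩),
        Turing.Tape.mk₁ ((encodePair y k).map P₂.inp)⟩) (by rw [hrun, hout])
    -- The inner stage starts in the state chosen by the outer one, not in `s₂`, so its run is taken
    -- from an arbitrary transducer state.
    obtain ⟨t₂, ht₂, hf₂⟩ := detYields_before (M := M) (T := T₂) (ends := ends₂) (s₀ := s₂)
      (hι := Function.injective_id) (encodePair y k)
      (mode ⟨y.length % K.size, Nat.mod_lt _ K.size_pos⟩)
    rw [List.map_id] at hf₂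
    rw [length_encodePair] at ht₁ ht₂
    refine ⟨t₁ + t₂, by rw [eval_add]; exact add_le_add ht₁ ht₂, fun j c hc hfin => ?_⟩
    rw [add_assoc]
    exact hf₁ _ _ (hf₂.yields_add ((yields_embed_iff _ _ _).2 ⟨c, hc, rfl⟩))
      ((embed_state_eq_final_iff c).2 hfin)
  refine ⟨before P₂ T₁ ends₁ s₁ id Function.injective_id,
    before_deterministic (before_deterministic hdet), timeBound T₁ + timeBound T₂ + p,
    fun y k => ?_⟩
  obtain ⟨t, ht, hf⟩ := key y k
  by_cases hy : K.size ∣ y.length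
  · have hmode : mode ⟨y.length % K.size, Nat.mod_lt _ K.size_pos⟩ =
        .inl (true, ⟨[], K.size_pos⟩) := if_pos (Nat.mod_eq_zero_of_dvd hy)
    rw [hmode, roundTransducer_output_inl] at hf
    obtain ⟨s', hs'⟩ := roundTransducer_run_inl K M.inp_ne_blank M.out_ne_blank
      (true, ⟨[], K.size_pos⟩) (encodePair y k)
    rw [hs'] at hf
    obtain ⟨j, hj, c, r, hc, hr, hlt⟩ := hp (K.round y) k
    refine ⟨t + j, ?_, _, r, hf j c hc.1 hc.2, embed_outputs (embed_outputs hr), ?_⟩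
    · rw [eval_add]
      refine add_le_add ht (hj.trans (eval_mono p (Nat.add_le_add_right ?_ k)))
      exact K.length_roundFrom_le _ y
    · rw [h₁ y hy]
      exact hlt
  · have hmode : mode ⟨y.length % K.size, Nat.mod_lt _ K.size_pos⟩ = .inr false :=
      if_neg fun h => hy (Nat.dvd_of_mod_eq_zero h)
    have hne : y ≠ [] := by
      rintro rfl
      exact hy (dvd_zero _)
    rw [hmode, roundTransducer_output_inr_false _ _ _ _ hne] at hf
    obtain ⟨s', hs'⟩ := roundTransducer_run_inr K M.inp_ne_blank M.out_ne_blank false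
      (encodePair y k)
    rw [hs'] at hf
    refine ⟨t + 0, ?_, _, false :: y, hf 0 _ rfl rfl, embed_outputs (embed_outputs rfl), ?_⟩
    · rw [eval_add]
      exact ht.trans (Nat.le_add_right _ _)
    -- The output is the exact value, whatever the precision asked for.
    · rw [h₂ y hy, sub_self, abs_zero]
      positivity

lemma inDistNP_target [Finite α] {D : DistProblem α} (hD : InDistNP D) :
    InDistNP (target K D) :=
  ⟨inNP_round_preimage K hD.1, ptimeComputableReal_of_round K hD.2
    (fun _ => distribution_target_of_dvd K D) fun _ => distribution_target_of_not_dvd K D⟩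

lemma isPtimeReduction_encode [Finite α] (D : DistProblem α) :
    IsPtimeReduction K.encode D.pos (target K D).pos := by
  refine ⟨ptimeComputable_encode K, fun x => ?_⟩
  change _ ↔ K.round (K.encode x) ∈ D.pos
  rw [K.round_encode]

lemma sizeInvariant_encode : SizeInvariant K.encode := fun x₁ x₂ => by
  rw [K.length_encode, K.length_encode]
  exact (Nat.mul_lt_mul_left K.size_pos).symm

end Target

/-- Over the empty alphabet there are no words of length 1, which could not carry total mass 1. The
block code needs a letter. -/
lemma DistProblem.nonempty {α : Type*} (D : DistProblem α) : Nonempty α := by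
  by_contra h
  rw [not_nonempty_iff] at h
  have h₀ : {x : List α | x.length = 1 ∧ x ∈ Set.univ} = ∅ := by
    ext x
    cases x with
    | nil => simp
    | cons a x => exact h.elim a
  have := D.total 1
  rw [mass, h₀, finsum_mem_empty] at this
  exact zero_ne_one this

end GenericNP

end

theorem mainTheorem7 {α : Type*} [Finite α] [LinearOrder α]
    (D : GenericNP.DistProblem α) (hD : GenericNP.InDistNP D) :
    ∃ (E : GenericNP.DistProblem Bool) (f : List α → List Bool) (S : ℕ → ℕ),
      GenericNP.InDistNP E ∧
      GenericNP.IsCSReduction f D E ∧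
      GenericNP.HasSizeGrowth f S ∧ (∃ c : ℕ, ∀ n, S n ≤ c * n) ∧
      GenericNP.IsSGPReduction f D E := by
  have := D.nonempty
  obtain ⟨K⟩ := GenericNP.exists_blockCode α
  have hE := GenericNP.inDistNP_target K hD
  have hred := GenericNP.isPtimeReduction_encode K D
  have hsize := GenericNP.sizeInvariant_encode K
  exact ⟨GenericNP.target K D, K.encode, fun n => K.size * n, hE,
    ⟨hD, hE, hred, hsize, GenericNP.isTransfer_encode K D⟩, K.length_encode,
    ⟨K.size, fun _ => le_rfl⟩, hD, hE, hred, hsize, fun M hM =>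
      ⟨GenericNP.exists_isComposition_encode K M hM.1,
        fun _ hP => GenericNP.sgpDecides_of_isComposition K D hM hP⟩⟩
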